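/- Let $\mathbb{C}^+=\{z\in\mathbb{C} : \operatorname{Im} z>0\}$. For a probability measure $\mu$ on $\mathbb{R}$ (on the Borel sets) let $$G_\mu(z)=\int_{\mathbb{R}}\frac{1}{z-t}\,d\mu(t),\qquad H_\mu(z)=\frac{1}{G_\mu(z)}-z\qquad(z\in\mathbb{C}^+).$$ Let $\mu$ and $\nu$ be arbitrary probability measures on $\mathbb{R}$. Then, for all $z,w\in\mathbb{C}^+$, one has $z+H_\mu(w)\in\mathbb{C}^+$, and $$g_z(w)=z+H_\nu\bigl(z+H_\mu(w)\bigr)$$ lies in $\mathbb{C}^+$, so that $g_z$ is a well-defined map $\mathbb{C}^+\to\mathbb{C}^+$. For each $z\in\mathbb{C}^+$ the map $g_z:\mathbb{C}^+\to\mathbb{C}^+$ has a unique fixed point $\omega(z)\in\mathbb{C}^+$, and $$\omega(z)=\lim_{n\to\infty} g_z^{\circ n}(z_0)\qquad\text{for every } z_0\in\mathbb{C}^+,$$ where $g_z^{\circ n}$ denotes the $n$-fold composition of $g_z$ with itself. Moreover, the function $\omega:\mathbb{C}^+\to\mathbb{C}^+$, $z\mapsto\omega(z)$, is analytic. -/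

import Mathlib

namespace FreeSubordination

open MeasureTheory UpperHalfPlane

/-- The Cauchy transform `G_μ(z) = ∫ 1/(z - t) dμ(t)`, for `z` in the open upper half-plane. -/
noncomputable def cauchyG (μ : Measure ℝ) (z : ℂ) : ℂ :=
  ∫ t : ℝ, 1 / (z - (t : ℂ)) ∂μ

/-- `H_μ(z) = 1/G_μ(z) - z`. -/
noncomputable def H (μ : Measure ℝ) (z : ℂ) : ℂ :=
  1 / cauchyG μ z - z

/-- `g_z(w) = z + H_ν(z + H_μ(w))`. -/
noncomputable def g (μ ν : Measure ℝ) (z w : ℂ) : ℂ :=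
  z + H ν (z + H μ w)

/-- The integral that defines the Cauchy transform converges on the upper half-plane. -/
theorem integrable_cauchyG (μ : Measure ℝ) [IsProbabilityMeasure μ] {z : ℂ} (hz : 0 < z.im) :
    Integrable (fun t : ℝ => 1 / (z - (t : ℂ))) μ := by
  refine Integrable.of_bound (C := 1 / z.im) (Measurable.aestronglyMeasurable (by fun_prop)) (Filter.Eventually.of_forall ?_)
  intro t
  have h : z.im ≤ ‖z - (t : ℂ)‖ := by
    have := Complex.abs_im_le_norm (z - (t : ℂ))
    simp only [Complex.sub_im, Complex.ofReal_im, sub_zero] at this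
    exact (le_abs_self _).trans this
  rw [norm_div, norm_one]
  gcongr

/-- The Cauchy transform maps the upper half-plane to the lower one; in particular it has no
zeros there, so the reciprocal in `H` is a genuine one. -/
theorem cauchyG_im_neg (μ : Measure ℝ) [IsProbabilityMeasure μ] {z : ℂ} (hz : 0 < z.im) :
    (cauchyG μ z).im < 0 := by
  have hi := integrable_cauchyG μ hz
  have hpt : ∀ t : ℝ, 0 < -(1 / (z - (t : ℂ))).im := by
    intro t
    have hne : z - (t : ℂ) ≠ 0 := by
      intro h
      have := congrArg Complex.im h
      simp at this
      exact hz.ne' this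
    have : 0 < Complex.normSq (z - (t : ℂ)) := Complex.normSq_pos.2 hne
    rw [one_div, Complex.inv_im]
    simp only [Complex.sub_im, Complex.ofReal_im, sub_zero, neg_div, neg_neg]
    exact div_pos hz this
  have him : (cauchyG μ z).im = ∫ t : ℝ, (1 / (z - (t : ℂ))).im ∂μ := by
    have := integral_im (𝕜 := ℂ) hi
    simpa [cauchyG] using this.symm
  have hint : Integrable (fun t : ℝ => -(1 / (z - (t : ℂ))).im) μ := (hi.im).neg
  have hpos : 0 < ∫ t : ℝ, -(1 / (z - (t : ℂ))).im ∂μ := by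
    rw [integral_pos_iff_support_of_nonneg (fun t => (hpt t).le) hint]
    have : Function.support (fun t : ℝ => -(1 / (z - (t : ℂ))).im) = Set.univ := by
      ext t
      simpa only [Function.mem_support, Set.mem_univ, iff_true] using (hpt t).ne'
    rw [this]
    simp
  rw [integral_neg] at hpos
  rw [him]
  linarith

end FreeSubordination

open Filter Topology

namespace FreeSubordination

open MeasureTheory

/-! Averaging `1/(z - t)` gives `Im H ≥ 0`, so `g_z` sends the upper half-plane into `Im ≥ c` with
`c = Im z > 0`. Schwarz–Pick applied to `g_z - ic` is then stronger than for a mere self-map: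
distances to a fixed point `p` contract by a definite factor. This yields uniqueness, convergence of
all orbits, and `g_z'(p) ≠ 1`; the implicit function theorem then makes `ω` analytic.

Existence is the harder part. Damping `g_z` by a Möbius map with parameter `ε` confines its image to
a horizontal strip, where it is a strict hyperbolic contraction and has a fixed point. As `ε → 0`
either these fixed points accumulate at a fixed point of `g_z`, or they escape to infinity and
Schwarz–Pick degenerates to `Im g_z(w) ≥ Im w` for every `w` (`exists_fixed_of_exists_im_lt`). The
second case would force `z + H_μ` to grow linearly along the imaginary axis
(`exists_le_im_of_comp`), whereas `iy G_μ(iy) → 1` gives `Im H_μ(iy) = o(y)`. -/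

/-! ### Schwarz–Pick inequalities in the upper half-plane. -/

theorem normSq_sub_conj (a b : ℂ) :
    ‖b - (starRingEnd ℂ) a‖ ^ 2 = ‖b - a‖ ^ 2 + 4 * (a.im * b.im) := by
  simp only [← Complex.normSq_eq_norm_sq, Complex.normSq_apply, Complex.sub_re, Complex.sub_im,
    Complex.conj_re, Complex.conj_im]
  ring

theorem norm_sub_lt_norm_sub_conj {a b : ℂ} (ha : 0 < a.im) (hb : 0 < b.im) :
    ‖b - a‖ < ‖b - (starRingEnd ℂ) a‖ := by
  have := normSq_sub_conj a b
  have : 0 < a.im * b.im := mul_pos ha hb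
  exact lt_of_pow_lt_pow_left₀ 2 (norm_nonneg _) (by linarith)

theorem sub_conj_ne_zero {a b : ℂ} (ha : 0 < a.im) (hb : 0 < b.im) :
    b - (starRingEnd ℂ) a ≠ 0 :=
  norm_pos_iff.1 ((norm_nonneg _).trans_lt (norm_sub_lt_norm_sub_conj ha hb))

theorem cayley_inv_im_pos {a ζ : ℂ} (ha : 0 < a.im) (hζ : ‖ζ‖ < 1) :
    0 < ((a - (starRingEnd ℂ) a * ζ) / (1 - ζ)).im := by
  have hne : 1 - ζ ≠ 0 := by
    intro h
    rw [← sub_eq_zero.1 h] at hζ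
    simp at hζ
  have hpos : 0 < Complex.normSq (1 - ζ) := Complex.normSq_pos.2 hne
  have h1 : Complex.normSq ζ < 1 := by
    rw [Complex.normSq_eq_norm_sq]
    exact pow_lt_one₀ (norm_nonneg _) hζ two_ne_zero
  have : ((a - (starRingEnd ℂ) a * ζ) / (1 - ζ)).im
      = a.im * (1 - Complex.normSq ζ) / Complex.normSq (1 - ζ) := by
    rw [Complex.div_im, ← sub_div]
    congr 1
    simp only [Complex.sub_re, Complex.sub_im, Complex.mul_re, Complex.mul_im,
      Complex.conj_re, Complex.conj_im, Complex.one_re, Complex.one_im, Complex.normSq_apply]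
    ring
  rw [this]
  exact div_pos (mul_pos ha (by linarith)) hpos

/-- The **Schwarz–Pick inequality** for self-maps of the open upper half-plane. -/
theorem schwarz_pick_of_im_pos {f : ℂ → ℂ} (hd : DifferentiableOn ℂ f {z | 0 < z.im})
    (hf : ∀ z : ℂ, 0 < z.im → 0 < (f z).im) {a b : ℂ} (ha : 0 < a.im) (hb : 0 < b.im) :
    ‖f b - f a‖ ^ 2 * (a.im * b.im) ≤ ‖b - a‖ ^ 2 * ((f a).im * (f b).im) := by
  -- Cayley maps with `φ 0 = a` and `ψ (f a) = 0` reduce the claim to the Schwarz lemma on the disc.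
  set φ : ℂ → ℂ := fun ζ => (a - (starRingEnd ℂ) a * ζ) / (1 - ζ) with hφ
  set ψ : ℂ → ℂ := fun w => (w - f a) / (w - (starRingEnd ℂ) (f a)) with hψ
  have hne : ∀ ζ ∈ Metric.ball (0 : ℂ) 1, 1 - ζ ≠ 0 := by
    intro ζ hζ h
    rw [← sub_eq_zero.1 h] at hζ
    simp at hζ
  have hφm : ∀ ζ ∈ Metric.ball (0 : ℂ) 1, 0 < (φ ζ).im := fun ζ hζ =>
    cayley_inv_im_pos ha (by simpa using hζ)
  have hφd : DifferentiableOn ℂ φ (Metric.ball 0 1) :=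
    DifferentiableOn.div (by fun_prop) (by fun_prop) hne
  have hψd : DifferentiableOn ℂ ψ {z | 0 < z.im} :=
    DifferentiableOn.div (by fun_prop) (by fun_prop) fun w hw => sub_conj_ne_zero (hf a ha) hw
  have hcomp : DifferentiableOn ℂ (ψ ∘ f ∘ φ) (Metric.ball 0 1) :=
    hψd.comp (hd.comp hφd hφm) fun ζ hζ => hf _ (hφm ζ hζ)
  have hmaps : Set.MapsTo (ψ ∘ f ∘ φ) (Metric.ball 0 1) (Metric.closedBall 0 1) := by
    intro ζ hζ
    have h := hf _ (hφm ζ hζ)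
    simp only [Function.comp, hψ, mem_closedBall_zero_iff, norm_div]
    exact div_le_one_of_le₀ (norm_sub_lt_norm_sub_conj (hf a ha) h).le (norm_nonneg _)
  have h0 : (ψ ∘ f ∘ φ) 0 = 0 := by simp [φ, ψ]
  have hbne := sub_conj_ne_zero ha hb
  have hane := sub_conj_ne_zero ha ha
  have hfne := sub_conj_ne_zero (hf a ha) (hf b hb)
  set ζ : ℂ := (b - a) / (b - (starRingEnd ℂ) a) with hζ
  have hφζ : φ ζ = b := by
    have h1 : 1 - ζ = (a - (starRingEnd ℂ) a) / (b - (starRingEnd ℂ) a) := by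
      rw [hζ]; field_simp; ring
    have h2 : a - (starRingEnd ℂ) a * ζ
        = b * (a - (starRingEnd ℂ) a) / (b - (starRingEnd ℂ) a) := by
      rw [hζ]; field_simp; ring
    simp only [hφ, h1, h2]
    field_simp
  have hζ1 : ‖ζ‖ < 1 := by
    rw [hζ, norm_div, div_lt_one (norm_pos_iff.2 hbne)]
    exact norm_sub_lt_norm_sub_conj ha hb
  have key := Complex.norm_le_norm_of_mapsTo_ball hcomp hmaps h0 hζ1
  simp only [Function.comp, hφζ, hψ] at key
  rw [hζ, norm_div, norm_div] at key
  rw [div_le_div_iff₀ (norm_pos_iff.2 hfne) (norm_pos_iff.2 hbne)] at key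
  have key2 := pow_le_pow_left₀ (by positivity) key 2
  -- The product of the two squared distances now appears on both sides and cancels.
  rw [mul_pow, mul_pow, normSq_sub_conj, normSq_sub_conj] at key2
  linarith

/-- The **Schwarz–Pick inequality** for maps to the closed upper half-plane. -/
theorem schwarz_pick {f : ℂ → ℂ} (hd : DifferentiableOn ℂ f {z | 0 < z.im})
    (hf : ∀ z : ℂ, 0 < z.im → 0 ≤ (f z).im) {a b : ℂ} (ha : 0 < a.im) (hb : 0 < b.im) :
    ‖f b - f a‖ ^ 2 * (a.im * b.im) ≤ ‖b - a‖ ^ 2 * ((f a).im * (f b).im) := by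
  have h : ∀ δ : ℝ, 0 < δ → ‖f b - f a‖ ^ 2 * (a.im * b.im)
      ≤ ‖b - a‖ ^ 2 * (((f a).im + δ) * ((f b).im + δ)) := by
    intro δ hδ
    have := schwarz_pick_of_im_pos (f := fun w => f w + δ * Complex.I) (hd.add_const _)
      (fun z hz => by simpa using add_pos_of_nonneg_of_pos (hf z hz) hδ) ha hb
    simpa using this
  have hlim : Tendsto (fun δ : ℝ => ‖b - a‖ ^ 2 * (((f a).im + δ) * ((f b).im + δ)))
      (𝓝[>] 0) (𝓝 (‖b - a‖ ^ 2 * (((f a).im + 0) * ((f b).im + 0)))) :=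
    (Continuous.tendsto (by fun_prop) 0).mono_left nhdsWithin_le_nhds
  simpa using ge_of_tendsto hlim (eventually_mem_nhdsWithin.mono fun δ hδ => h δ hδ)

/-- The subtracted `c` is the gain over plain Schwarz–Pick that drives every contraction below. -/
theorem schwarz_pick_of_le_im {f : ℂ → ℂ} {c : ℝ} (hd : DifferentiableOn ℂ f {z | 0 < z.im})
    (hf : ∀ z : ℂ, 0 < z.im → c ≤ (f z).im) {a b : ℂ} (ha : 0 < a.im) (hb : 0 < b.im) :
    ‖f b - f a‖ ^ 2 * (a.im * b.im) ≤ ‖b - a‖ ^ 2 * (((f a).im - c) * ((f b).im - c)) := by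
  have := schwarz_pick (f := fun w => f w - c * Complex.I) (hd.sub_const _)
    (fun z hz => by simpa using hf z hz) ha hb
  simpa using this

/-! ### Attraction, uniqueness and multiplier of a fixed point. -/

theorem iterate_im_ge {f : ℂ → ℂ} {c : ℝ} (hc : 0 < c) (hf : ∀ z : ℂ, 0 < z.im → c ≤ (f z).im)
    {a : ℂ} (ha : 0 < a.im) (n : ℕ) : 0 < (f^[n] a).im := by
  induction n with
  | zero => exact ha
  | succ n ih => rw [Function.iterate_succ_apply']; exact hc.trans_le (hf _ ih)

/-- If a map of the upper half-plane to a smaller half-plane has a fixed point, then all its orbits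
converge to it. -/
theorem tendsto_iterate_of_fixed {f : ℂ → ℂ} {c : ℝ} (hc : 0 < c)
    (hd : DifferentiableOn ℂ f {z | 0 < z.im}) (hf : ∀ z : ℂ, 0 < z.im → c ≤ (f z).im)
    {p : ℂ} (hp : 0 < p.im) (hfp : f p = p) {a : ℂ} (ha : 0 < a.im) :
    Tendsto (fun n => f^[n] a) atTop (𝓝 p) := by
  set k : ℝ := 1 - c / p.im with hk
  have hcp : c ≤ p.im := hfp ▸ hf p hp
  have hk0 : 0 ≤ k := by
    rw [hk, sub_nonneg, div_le_one hp]; exact hcp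
  have hk1 : k < 1 := by
    have : 0 < c / p.im := by positivity
    linarith
  have hkp : p.im - c = k * p.im := by rw [hk]; field_simp
  -- Up to a constant depending on `p`, this quotient is `sinh²(d/2)` for the hyperbolic distance
  -- `d` from `b` to `p`.
  have step : ∀ b : ℂ, 0 < b.im → ‖f b - p‖ ^ 2 / (f b).im ≤ k * (‖b - p‖ ^ 2 / b.im) := by
    intro b hb
    have h := schwarz_pick_of_le_im hd hf hp hb
    have hfb : 0 < (f b).im := hc.trans_le (hf b hb)
    rw [hfp, hkp] at h
    have h2 : ‖f b - p‖ ^ 2 * b.im ≤ ‖b - p‖ ^ 2 * (k * (f b).im) := by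
      refine le_of_mul_le_mul_right ?_ hp
      calc ‖f b - p‖ ^ 2 * b.im * p.im = ‖f b - p‖ ^ 2 * (p.im * b.im) := by ring
        _ ≤ _ := h
        _ ≤ ‖b - p‖ ^ 2 * (k * p.im * (f b).im) := by gcongr; linarith
        _ = _ := by ring
    rw [← mul_div_assoc, div_le_div_iff₀ hfb hb]
    linarith
  have hn : ∀ n, ‖f^[n] a - p‖ ^ 2 / (f^[n] a).im ≤ k ^ n * (‖a - p‖ ^ 2 / a.im) := by
    intro n
    induction n with
    | zero => simp
    | succ n ih =>
      rw [Function.iterate_succ_apply']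
      calc _ ≤ _ := step _ (iterate_im_ge hc hf ha n)
        _ ≤ k * (k ^ n * (‖a - p‖ ^ 2 / a.im)) := by gcongr
        _ = _ := by ring
  set ε : ℕ → ℝ := fun n => k ^ n * (‖a - p‖ ^ 2 / a.im)
  have hε : Tendsto ε atTop (𝓝 0) := by
    simpa using (tendsto_pow_atTop_nhds_zero_of_lt_one hk0 hk1).mul_const (‖a - p‖ ^ 2 / a.im)
  -- The denominator `Im (f^[n] a)` has no a priori upper bound; it is at most `Im p` plus the
  -- distance to `p`, and the resulting quadratic inequality is solved for that distance.
  have hbound : ∀ n, ‖f^[n] a - p‖ ^ 2 ≤ 2 * ε n * p.im + ε n ^ 2 := by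
    intro n
    have h1 := hn n
    have him := iterate_im_ge hc hf ha n
    rw [div_le_iff₀ him] at h1
    have h2 : (f^[n] a).im ≤ p.im + ‖f^[n] a - p‖ := by
      have := (le_abs_self _).trans (Complex.abs_im_le_norm (f^[n] a - p))
      rw [Complex.sub_im] at this
      linarith
    have hε0 : 0 ≤ ε n := by positivity
    have h3 : ‖f^[n] a - p‖ ^ 2 ≤ ε n * (p.im + ‖f^[n] a - p‖) :=
      h1.trans (mul_le_mul_of_nonneg_left h2 hε0)
    nlinarith [sq_nonneg (ε n - ‖f^[n] a - p‖)]
  have hlim : Tendsto (fun n => 2 * ε n * p.im + ε n ^ 2) atTop (𝓝 0) := by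
    simpa using ((hε.const_mul 2).mul_const p.im).add (hε.pow 2)
  have hsq : Tendsto (fun n => ‖f^[n] a - p‖ ^ 2) atTop (𝓝 0) :=
    squeeze_zero (fun n => by positivity) hbound hlim
  rw [tendsto_iff_norm_sub_tendsto_zero]
  simpa using hsq.sqrt

theorem fixed_unique {f : ℂ → ℂ} {c : ℝ} (hc : 0 < c)
    (hd : DifferentiableOn ℂ f {z | 0 < z.im}) (hf : ∀ z : ℂ, 0 < z.im → c ≤ (f z).im)
    {p q : ℂ} (hp : 0 < p.im) (hfp : f p = p) (hq : 0 < q.im) (hfq : f q = q) : q = p := by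
  have h := tendsto_iterate_of_fixed hc hd hf hp hfp hq
  simp only [Function.iterate_fixed hfq] at h
  exact tendsto_nhds_unique tendsto_const_nhds h

/-- Dividing Schwarz–Pick by `‖b - p‖²` and letting `b → p` gives `|d| Im p ≤ Im p - c < Im p`. -/
theorem deriv_ne_one_of_fixed {f : ℂ → ℂ} {c : ℝ} (hc : 0 < c)
    (hd : DifferentiableOn ℂ f {z | 0 < z.im}) (hf : ∀ z : ℂ, 0 < z.im → c ≤ (f z).im)
    {p d : ℂ} (hp : 0 < p.im) (hfp : f p = p) (hfd : HasDerivAt f d p) : d ≠ 1 := by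
  rintro rfl
  have hcp : c ≤ p.im := hfp ▸ hf p hp
  have hs := (hasDerivAt_iff_tendsto_slope.1 hfd).norm.pow 2
  have him : Tendsto (fun b : ℂ => b.im) (𝓝[≠] p) (𝓝 p.im) :=
    (Complex.continuous_im.tendsto p).mono_left nhdsWithin_le_nhds
  have hfim : Tendsto (fun b : ℂ => (f b).im) (𝓝[≠] p) (𝓝 (f p).im) :=
    ((Complex.continuous_im.tendsto _).comp hfd.continuousAt.tendsto).mono_left nhdsWithin_le_nhds
  have hle := le_of_tendsto_of_tendsto (hs.mul (him.const_mul p.im))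
    ((hfim.sub_const c).const_mul ((f p).im - c)) (by
      filter_upwards [him.eventually (lt_mem_nhds hp), self_mem_nhdsWithin] with b hb hbp
      have h := schwarz_pick_of_le_im hd hf hp hb
      have hpos : 0 < ‖b - p‖ ^ 2 := by
        have := norm_pos_iff.2 (sub_ne_zero.2 hbp)
        positivity
      rw [slope_def_field, norm_div, div_pow, div_mul_eq_mul_div, div_le_iff₀ hpos]
      linarith)
  rw [hfp] at hle
  simp only [norm_one, one_pow, one_mul] at hle
  nlinarith

/-! ### Existence of fixed points. -/

/-- A map of the upper half-plane to a horizontal strip `0 < c ≤ Im z ≤ M` has a fixed point. -/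
theorem exists_fixed_of_im_le {f : ℂ → ℂ} {c M : ℝ} (hc : 0 < c)
    (hd : DifferentiableOn ℂ f {z | 0 < z.im}) (hf : ∀ z : ℂ, 0 < z.im → c ≤ (f z).im)
    (hM : ∀ z : ℂ, 0 < z.im → (f z).im ≤ M) : ∃ p : ℂ, c ≤ p.im ∧ f p = p := by
  have hI : 0 < (Complex.I).im := by simp
  have hcM : c ≤ M := (hf _ hI).trans (hM _ hI)
  have hM0 : 0 < M := hc.trans_le hcM
  set k : ℝ := 1 - c / M with hk
  have hk0 : 0 ≤ k := by
    rw [hk, sub_nonneg, div_le_one hM0]; exact hcM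
  have hk1 : k < 1 := by
    have : 0 < c / M := by positivity
    linarith
  have hkim : ∀ t : ℝ, t ≤ M → t - c ≤ k * t := by
    intro t ht
    have : c / M * t ≤ c := by
      rw [div_mul_eq_mul_div, div_le_iff₀ hM0]
      exact mul_le_mul_of_nonneg_left ht hc.le
    rw [hk]; linarith
  -- The orbit starts at `f I`, since `I` itself need not satisfy the bounds `c` and `M`.
  set w : ℕ → ℂ := fun n => f^[n + 1] Complex.I with hw
  have hws : ∀ n, w (n + 1) = f (w n) := fun n => Function.iterate_succ_apply' f (n + 1) _
  have hwim : ∀ n, c ≤ (w n).im ∧ (w n).im ≤ M := by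
    intro n
    have := iterate_im_ge hc hf hI n
    simp only [hw, Function.iterate_succ_apply']
    exact ⟨hf _ this, hM _ this⟩
  have hwpos : ∀ n, 0 < (w n).im := fun n => hc.trans_le (hwim n).1
  set r : ℕ → ℝ := fun n => ‖w (n + 1) - w n‖ ^ 2 / ((w n).im * (w (n + 1)).im) with hr
  have hrstep : ∀ n, r (n + 1) ≤ k ^ 2 * r n := by
    intro n
    have h := schwarz_pick_of_le_im hd hf (hwpos n) (hwpos (n + 1))
    rw [← hws, ← hws] at h
    simp only [hr]
    rw [← mul_div_assoc, div_le_div_iff₀ (mul_pos (hwpos _) (hwpos _))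
      (mul_pos (hwpos _) (hwpos _))]
    refine h.trans ?_
    have h1 := hkim _ (hwim (n + 1)).2
    have h2 := hkim _ (hwim (n + 1 + 1)).2
    calc _ ≤ ‖w (n + 1) - w n‖ ^ 2 * ((k * (w (n + 1)).im) * (k * (w (n + 1 + 1)).im)) := by
          have h3 := (hwim (n + 1 + 1)).1
          have h4 := (hwpos (n + 1)).le
          gcongr
      _ = _ := by ring
  have hrn : ∀ n, r n ≤ (k ^ n) ^ 2 * r 0 := by
    intro n
    induction n with
    | zero => simp
    | succ n ih =>
      calc _ ≤ _ := hrstep n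
        _ ≤ k ^ 2 * ((k ^ n) ^ 2 * r 0) := by gcongr
        _ = _ := by ring
  have hr0 : 0 ≤ r 0 := div_nonneg (by positivity) (mul_pos (hwpos _) (hwpos _)).le
  have hdist : ∀ n, dist (w n) (w (n + 1)) ≤ (Real.sqrt (r 0) * M) * k ^ n := by
    intro n
    rw [dist_comm, dist_eq_norm]
    refine le_of_sq_le_sq ?_ (by positivity)
    have h1 := hrn n
    simp only [hr] at h1
    rw [div_le_iff₀ (mul_pos (hwpos _) (hwpos _))] at h1
    refine h1.trans ?_
    rw [mul_pow, mul_pow, Real.sq_sqrt hr0]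
    have h2 : (w n).im * (w (n + 1)).im ≤ M * M :=
      mul_le_mul (hwim n).2 (hwim (n + 1)).2 (hwpos _).le hM0.le
    calc _ ≤ (k ^ n) ^ 2 * r 0 * (M * M) := mul_le_mul_of_nonneg_left h2 (by positivity)
      _ = _ := by ring
  obtain ⟨p, hp⟩ := cauchySeq_tendsto_of_complete (cauchySeq_of_le_geometric k _ hk1 hdist)
  have hpc : c ≤ p.im :=
    ge_of_tendsto ((Complex.continuous_im.tendsto p).comp hp) (Eventually.of_forall fun n =>
      (hwim n).1)
  refine ⟨p, hpc, ?_⟩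
  have hopen : IsOpen {z : ℂ | 0 < z.im} := isOpen_lt continuous_const Complex.continuous_im
  have hcont : ContinuousAt f p :=
    (hd.differentiableAt (hopen.mem_nhds (hc.trans_le hpc))).continuousAt
  have h1 : Tendsto (fun n => w (n + 1)) atTop (𝓝 (f p)) := by
    simp only [hws]
    exact hcont.tendsto.comp hp
  exact tendsto_nhds_unique h1 (hp.comp (tendsto_add_atTop_nat 1))

/-- Used to pass to the limit in Schwarz–Pick when one point goes to infinity, where hyperbolic
disks become horodisks. -/
theorem tendsto_norm_sub_div_norm {ι : Type*} {l : Filter ι} {y p : ι → ℂ} {y₀ : ℂ}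
    (hy : Tendsto y l (𝓝 y₀)) (hp : Tendsto (fun n => ‖p n‖) l atTop) :
    Tendsto (fun n => ‖y n - p n‖ / ‖p n‖) l (𝓝 1) := by
  have h1 : Tendsto (fun n => (p n)⁻¹) l (𝓝 0) :=
    tendsto_inv₀_cobounded.comp (tendsto_norm_atTop_iff_cobounded.1 hp)
  have h2 : Tendsto (fun n => ‖y n * (p n)⁻¹ - 1‖) l (𝓝 1) := by
    simpa using ((hy.mul h1).sub_const 1).norm
  refine h2.congr' ?_
  filter_upwards [hp.eventually_gt_atTop 0] with n hn
  rw [← norm_div, sub_div, div_self (norm_pos_iff.1 hn), div_eq_mul_inv]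

theorem one_le_norm_one_sub {h : ℂ} {ε : ℝ} (hε : 0 ≤ ε) (hh : 0 ≤ h.im) :
    1 ≤ ‖1 - ε * Complex.I * h‖ := by
  refine le_trans ?_ (Complex.re_le_norm _)
  simpa using mul_nonneg hε hh

theorem im_damped_nonneg {h : ℂ} {ε : ℝ} (hε : 0 ≤ ε) (hh : 0 ≤ h.im) :
    0 ≤ (h / (1 - ε * Complex.I * h)).im := by
  have : (h / (1 - ε * Complex.I * h)).im
      = (h.im + ε * Complex.normSq h) / Complex.normSq (1 - ε * Complex.I * h) := by
    rw [Complex.div_im, ← sub_div]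
    congr 1
    simp [Complex.normSq_apply]
    ring
  rw [this]
  have := Complex.normSq_nonneg h
  have := Complex.normSq_nonneg (1 - ε * Complex.I * h)
  positivity

/-- For `h ≠ 0` the damped value is `1/(1/h - iε)`, and `Im (1/h - iε) ≤ -ε`. -/
theorem norm_damped_le {h : ℂ} {ε : ℝ} (hε : 0 < ε) (hh : 0 ≤ h.im) :
    ‖h / (1 - ε * Complex.I * h)‖ ≤ 1 / ε := by
  have h0 : 0 < ‖1 - ε * Complex.I * h‖ := one_pos.trans_le (one_le_norm_one_sub hε.le hh)
  rw [norm_div, div_le_div_iff₀ h0 hε, one_mul]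
  refine le_of_sq_le_sq ?_ h0.le
  rw [mul_pow, ← Complex.normSq_eq_norm_sq, ← Complex.normSq_eq_norm_sq]
  have h2 : 0 ≤ ε * h.im := mul_nonneg hε.le hh
  simp [Complex.normSq_apply]
  nlinarith

/-- A special case of the **Denjoy–Wolff theorem**: a map of the upper half-plane to a smaller
half-plane that does not leave all horodisks at infinity invariant has a fixed point. -/
theorem exists_fixed_of_exists_im_lt {f : ℂ → ℂ} {c : ℝ} (hc : 0 < c)
    (hd : DifferentiableOn ℂ f {z | 0 < z.im}) (hf : ∀ z : ℂ, 0 < z.im → c ≤ (f z).im)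
    (hw : ∃ x : ℂ, 0 < x.im ∧ (f x).im < x.im) : ∃ p : ℂ, 0 < p.im ∧ f p = p := by
  set h : ℂ → ℂ := fun w => f w - c * Complex.I with hh
  have hhim : ∀ w : ℂ, 0 < w.im → 0 ≤ (h w).im := fun w hw => by simpa [hh] using hf w hw
  have hhd : DifferentiableOn ℂ h {z | 0 < z.im} := hd.sub_const _
  set ε : ℕ → ℝ := fun n => 1 / ((n : ℝ) + 1) with hε
  have hε0 : ∀ n, 0 < ε n := fun n => Nat.one_div_pos_of_nat
  have hεlim : Tendsto ε atTop (𝓝 0) := tendsto_one_div_add_atTop_nhds_zero_nat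
  set F : ℕ → ℂ → ℂ := fun n w => c * Complex.I + h w / (1 - ε n * Complex.I * h w) with hF
  have hFd : ∀ n, DifferentiableOn ℂ (F n) {z | 0 < z.im} := fun n =>
    (hhd.div ((hhd.const_mul _).const_sub _) fun w hw =>
      norm_pos_iff.1 (one_pos.trans_le (one_le_norm_one_sub (hε0 n).le (hhim w hw)))).const_add _
  have hFc : ∀ n, ∀ w : ℂ, 0 < w.im → c ≤ (F n w).im := by
    intro n w hw
    have := im_damped_nonneg (hε0 n).le (hhim w hw)
    simp only [hF, Complex.add_im, Complex.im_ofReal_mul, Complex.I_im, mul_one]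
    linarith
  have hFM : ∀ n, ∀ w : ℂ, 0 < w.im → (F n w).im ≤ c + 1 / ε n := by
    intro n w hw
    have h1 := norm_damped_le (hε0 n) (hhim w hw)
    have h2 := (le_abs_self _).trans (Complex.abs_im_le_norm (h w / (1 - ε n * Complex.I * h w)))
    simp only [hF, Complex.add_im, Complex.im_ofReal_mul, Complex.I_im, mul_one]
    linarith
  have hFlim : ∀ {u : ℕ → ℂ} {q : ℂ} {φ : ℕ → ℕ}, Tendsto φ atTop atTop → 0 < q.im →
      Tendsto u atTop (𝓝 q) → Tendsto (fun n => F (φ n) (u n)) atTop (𝓝 (f q)) := by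
    intro u q φ hφ hq hu
    have hopen : IsOpen {z : ℂ | 0 < z.im} := isOpen_lt continuous_const Complex.continuous_im
    have hhu : Tendsto (fun n => h (u n)) atTop (𝓝 (h q)) :=
      (hhd.differentiableAt (hopen.mem_nhds hq)).continuousAt.tendsto.comp hu
    have hεc : Tendsto (fun n => (ε (φ n) : ℂ)) atTop (𝓝 0) := by
      exact_mod_cast (Complex.continuous_ofReal.tendsto 0).comp (hεlim.comp hφ)
    have hden : Tendsto (fun n => 1 - ε (φ n) * Complex.I * h (u n)) atTop (𝓝 1) := by
      simpa using ((hεc.mul_const Complex.I).mul hhu).const_sub 1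
    simpa [hh] using (hhu.div hden one_ne_zero).const_add (c * Complex.I)
  choose p hpc hfp using fun n => exists_fixed_of_im_le hc (hFd n) (hFc n) (hFM n)
  have hp0 : ∀ n, 0 < (p n).im := fun n => hc.trans_le (hpc n)
  by_cases hb : ∃ R : ℝ, ∃ᶠ n in atTop, p n ∈ Metric.closedBall (0 : ℂ) R
  · obtain ⟨R, hR⟩ := hb
    obtain ⟨q, -, φ, hφ, hq⟩ := tendsto_subseq_of_frequently_bounded Metric.isBounded_closedBall hR
    have hqc : c ≤ q.im :=
      ge_of_tendsto ((Complex.continuous_im.tendsto q).comp hq)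
        (Eventually.of_forall fun n => hpc (φ n))
    have hq0 := hc.trans_le hqc
    refine ⟨q, hq0, ?_⟩
    have h1 := hFlim hφ.tendsto_atTop hq0 hq
    simp only [Function.comp_apply, hfp] at h1
    exact tendsto_nhds_unique h1 hq
  · exfalso
    push Not at hb
    have hpinf : Tendsto (fun n => ‖p n‖) atTop atTop := by
      refine tendsto_atTop.2 fun R => (hb R).mono fun n hn => ?_
      rw [mem_closedBall_zero_iff, not_le] at hn
      exact hn.le
    obtain ⟨x, hx, hfx⟩ := hw
    have hFx := hFlim tendsto_id hx (tendsto_const_nhds (x := x))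
    have hl := ((tendsto_norm_sub_div_norm hFx hpinf).pow 2).mul_const x.im
    have hr := ((tendsto_norm_sub_div_norm (tendsto_const_nhds (x := x)) hpinf).pow 2).mul
      ((Complex.continuous_im.tendsto _).comp hFx)
    -- Schwarz–Pick between `p n` and `x`, divided by `Im (p n) ‖p n‖²`, tends to `Im x ≤ Im f(x)`.
    have hle := le_of_tendsto_of_tendsto hl hr (by
      filter_upwards [hpinf.eventually_gt_atTop 0] with n hn
      have h1 := schwarz_pick (hFd n) (fun z hz => hc.le.trans (hFc n z hz)) (hp0 n) hx
      rw [hfp] at h1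
      simp only [id, div_pow, Function.comp_apply, div_mul_eq_mul_div]
      refine div_le_div_of_nonneg_right (le_of_mul_le_mul_right ?_ (hp0 n)) (by positivity)
      linarith)
    simp only [one_pow, one_mul] at hle
    linarith

/-- If `f ∘ g` leaves all horodisks at infinity invariant, then the imaginary part of `g` grows
linearly along the imaginary axis. -/
theorem exists_le_im_of_comp {f g : ℂ → ℂ} {c : ℝ} (hc : 0 < c)
    (hfd : DifferentiableOn ℂ f {z | 0 < z.im}) (hgd : DifferentiableOn ℂ g {z | 0 < z.im})
    (hf : ∀ z : ℂ, 0 < z.im → 0 < (f z).im) (hg : ∀ z : ℂ, 0 < z.im → c ≤ (g z).im)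
    (hfg : ∀ z : ℂ, 0 < z.im → z.im ≤ (f (g z)).im) :
    ∃ K : ℝ, 0 < K ∧ ∀ x : ℂ, 0 < x.im → x.im ≤ K * (g x).im := by
  have hI : 0 < (Complex.I).im := by simp
  have hg0 : ∀ z : ℂ, 0 < z.im → 0 < (g z).im := fun z hz => hc.trans_le (hg z hz)
  have hm : 0 < (f Complex.I).im := hf _ hI
  set m : ℝ := (f Complex.I).im with hmdef
  set w : ℝ → ℂ := fun y => g (y * Complex.I) with hwdef
  have hyim : ∀ y : ℝ, ((y : ℂ) * Complex.I).im = y := fun y => by simp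
  -- For `y ≥ 2m`, `Im f(w y) ≥ y` is at least twice `Im f(i)`, so `‖f(w y) - f(i)‖ ≥ Im f(w y) /
  -- 2`; Schwarz–Pick for `f` does the rest.
  have key : ∀ y : ℝ, 0 < y → 2 * m ≤ y →
      y * (w y).im ≤ 4 * m * ‖Complex.I - w y‖ ^ 2 := by
    intro y hy hy2
    have hypos : 0 < ((y : ℂ) * Complex.I).im := by rwa [hyim]
    have hw0 : 0 < (w y).im := hg0 _ hypos
    have hY : y ≤ (f (w y)).im := by simpa only [hyim] using hfg _ hypos
    have hY0 : 0 < (f (w y)).im := hy.trans_le hY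
    have h1 := schwarz_pick hfd (fun z hz => (hf z hz).le) hI hw0
    have h2 : (f (w y)).im / 2 ≤ ‖f (w y) - f Complex.I‖ := by
      have := (le_abs_self _).trans (Complex.abs_im_le_norm (f (w y) - f Complex.I))
      rw [Complex.sub_im] at this
      linarith
    have h3 := pow_le_pow_left₀ (by positivity) h2 2
    rw [Complex.I_im, one_mul] at h1
    have h4 : ((f (w y)).im / 2) ^ 2 * (w y).im
        ≤ ‖w y - Complex.I‖ ^ 2 * (m * (f (w y)).im) :=
      (mul_le_mul_of_nonneg_right h3 hw0.le).trans h1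
    have h5 : (f (w y)).im * (w y).im ≤ 4 * m * ‖w y - Complex.I‖ ^ 2 := by
      refine le_of_mul_le_mul_right ?_ hY0
      linarith
    rw [norm_sub_rev]
    exact (mul_le_mul_of_nonneg_right hY hw0.le).trans h5
  have hev : ∀ᶠ y : ℝ in atTop, 0 < y ∧ 2 * m ≤ y :=
    (eventually_gt_atTop 0).and (eventually_ge_atTop _)
  have hsq : Tendsto (fun y => ‖Complex.I - w y‖ ^ 2) atTop atTop := by
    have hlin : Tendsto (fun y : ℝ => c / (4 * m) * y) atTop atTop :=
      tendsto_id.const_mul_atTop (by positivity)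
    refine tendsto_atTop_mono' _ ?_ hlin
    filter_upwards [hev] with y hy
    have h1 := key y hy.1 hy.2
    have h2 : c ≤ (w y).im := hg _ (by rw [hyim]; exact hy.1)
    rw [div_mul_eq_mul_div, div_le_iff₀ (by positivity)]
    nlinarith [mul_le_mul_of_nonneg_left h2 hy.1.le]
  have hnorm : Tendsto (fun y => ‖w y - Complex.I‖) atTop atTop := by
    have := Real.tendsto_sqrt_atTop.comp hsq
    refine this.congr fun y => ?_
    rw [Function.comp_apply, Real.sqrt_sq (norm_nonneg _), norm_sub_rev]
  have hynorm : Tendsto (fun y : ℝ => ‖(y : ℂ) * Complex.I‖) atTop atTop := by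
    simpa using tendsto_abs_atTop_atTop
  refine ⟨4 * m, by positivity, fun x hx => ?_⟩
  have hl := ((tendsto_norm_sub_div_norm (tendsto_const_nhds (x := g x - Complex.I))
    hnorm).pow 2).mul_const x.im
  have hr := ((tendsto_norm_sub_div_norm (tendsto_const_nhds (x := x)) hynorm).pow 2).mul_const
    (4 * m * (g x).im)
  -- Schwarz–Pick for `g` between `iy` and `x`; `key` eliminates `Im (w y)`, and both distance
  -- ratios tend to 1.
  have hle := le_of_tendsto_of_tendsto hl hr (by
    filter_upwards [hev, hnorm.eventually_gt_atTop 0] with y hy hn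
    have hypos : 0 < ((y : ℂ) * Complex.I).im := by rw [hyim]; exact hy.1
    have hw0 : 0 < (w y).im := hg0 _ hypos
    have h1 := schwarz_pick hgd (fun z hz => (hg0 z hz).le) hypos hx
    have h2 := key y hy.1 hy.2
    rw [hyim] at h1
    have hny : ‖(y : ℂ) * Complex.I‖ = y := by simp [abs_of_pos hy.1]
    rw [hny, sub_sub_sub_cancel_right, div_pow, div_pow, div_mul_eq_mul_div, div_mul_eq_mul_div,
      div_le_div_iff₀ (by positivity) (by have := hy.1; positivity)]
    have hy0 := hy.1
    calc ‖g x - w y‖ ^ 2 * x.im * y ^ 2 = ‖g x - w y‖ ^ 2 * (y * x.im) * y := by ring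
      _ ≤ ‖x - y * Complex.I‖ ^ 2 * ((w y).im * (g x).im) * y := by gcongr
      _ = ‖x - y * Complex.I‖ ^ 2 * (g x).im * (y * (w y).im) := by ring
      _ ≤ ‖x - y * Complex.I‖ ^ 2 * (g x).im * (4 * m * ‖Complex.I - w y‖ ^ 2) := by
          have := (hg0 x hx).le
          gcongr
      _ = _ := by rw [norm_sub_rev Complex.I]; ring)
  simpa using hle

/-! ### Analyticity, sign and growth of the Cauchy transform and `H`. -/

theorem sub_ofReal_ne_zero {z : ℂ} (hz : 0 < z.im) (t : ℝ) : z - (t : ℂ) ≠ 0 := by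
  intro h
  have := congrArg Complex.im h
  simp at this
  exact hz.ne' this

theorem im_le_norm_sub_ofReal {z : ℂ} (t : ℝ) : z.im ≤ ‖z - (t : ℂ)‖ := by
  have := (le_abs_self _).trans (Complex.abs_im_le_norm (z - (t : ℂ)))
  simpa using this

theorem cauchyG_ne_zero (μ : Measure ℝ) [IsProbabilityMeasure μ] {z : ℂ} (hz : 0 < z.im) :
    cauchyG μ z ≠ 0 := by
  intro h
  have := cauchyG_im_neg μ hz
  simp [h] at this

theorem differentiableAt_cauchyG (μ : Measure ℝ) [IsProbabilityMeasure μ] {z : ℂ}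
    (hz : 0 < z.im) : DifferentiableAt ℂ (cauchyG μ) z := by
  have hopen : IsOpen {w : ℂ | z.im / 2 < w.im} := isOpen_lt continuous_const Complex.continuous_im
  have hpos : ∀ w ∈ {w : ℂ | z.im / 2 < w.im}, 0 < w.im := fun w hw => (half_pos hz).trans hw
  have key := hasDerivAt_integral_of_dominated_loc_of_deriv_le (μ := μ) (𝕜 := ℂ)
    (F := fun (w : ℂ) (t : ℝ) => 1 / (w - (t : ℂ)))
    (F' := fun (w : ℂ) (t : ℝ) => -1 / (w - (t : ℂ)) ^ 2)
    (bound := fun _ => 1 / (z.im / 2) ^ 2)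
    (hopen.mem_nhds (show z.im / 2 < z.im by linarith))
    (Eventually.of_forall fun w => Measurable.aestronglyMeasurable (by fun_prop))
    (integrable_cauchyG μ hz)
    (Measurable.aestronglyMeasurable (by fun_prop))
    (Eventually.of_forall fun t w hw => by
      have h1 : z.im / 2 ≤ ‖w - (t : ℂ)‖ :=
        (show z.im / 2 < w.im from hw).le.trans (im_le_norm_sub_ofReal t)
      rw [norm_div, norm_neg, norm_one, norm_pow]
      gcongr)
    (integrable_const _)
    (Eventually.of_forall fun t w hw => by
      have h : HasDerivAt (fun x : ℂ => (x - (t : ℂ))⁻¹) (-1 / (w - (t : ℂ)) ^ 2) w :=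
        ((hasDerivAt_id w).sub_const (t : ℂ)).inv (sub_ofReal_ne_zero (hpos w hw) t)
      simpa only [one_div] using h)
  exact key.2.differentiableAt

theorem differentiableAt_H (μ : Measure ℝ) [IsProbabilityMeasure μ] {z : ℂ}
    (hz : 0 < z.im) : DifferentiableAt ℂ (H μ) z :=
  ((differentiableAt_const 1).div (differentiableAt_cauchyG μ hz)
    (cauchyG_ne_zero μ hz)).sub differentiableAt_id

theorem differentiableOn_H (μ : Measure ℝ) [IsProbabilityMeasure μ] :
    DifferentiableOn ℂ (H μ) {z | 0 < z.im} :=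
  fun _ hz => (differentiableAt_H μ hz).differentiableWithinAt

/-- All values `1/(z - t)` lie on the circle with centre `-i/(2 Im z)` and radius `1/(2 Im z)`, so
their mean `G` lies in the closed disk, which for `G ≠ 0` means `Im (1/G) ≥ Im z`. -/
theorem im_H_nonneg (μ : Measure ℝ) [IsProbabilityMeasure μ] {z : ℂ} (hz : 0 < z.im) :
    0 ≤ (H μ z).im := by
  set a : ℂ := ((1 / (2 * z.im) : ℝ) : ℂ) * Complex.I with ha
  have hpt : ∀ t : ℝ, ‖1 / (z - (t : ℂ)) + a‖ ≤ 1 / (2 * z.im) := by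
    intro t
    have hne := sub_ofReal_ne_zero hz t
    have hzc : ((z.im : ℝ) : ℂ) ≠ 0 := by exact_mod_cast hz.ne'
    have h1 : 1 / (z - (t : ℂ)) + a
        = a * ((starRingEnd ℂ) (z - (t : ℂ)) / (z - (t : ℂ))) := by
      have hconj : (starRingEnd ℂ) (z - (t : ℂ)) = (z - (t : ℂ)) - 2 * z.im * Complex.I := by
        apply Complex.ext <;> simp
        ring
      rw [hconj, ha]
      push_cast
      field_simp
      linear_combination (2 * z.im : ℂ) * Complex.I_sq
    rw [h1, norm_mul, norm_div, RCLike.norm_conj, div_self (norm_ne_zero_iff.2 hne), mul_one, ha,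
      norm_mul, Complex.norm_I, mul_one, Complex.norm_real, Real.norm_of_nonneg (by positivity)]
  have hint := integrable_cauchyG μ hz
  have hG : ‖cauchyG μ z + a‖ ≤ 1 / (2 * z.im) := by
    have h1 : cauchyG μ z + a = ∫ t : ℝ, (1 / (z - (t : ℂ)) + a) ∂μ := by
      rw [integral_add hint (integrable_const _)]
      simp [cauchyG]
    rw [h1]
    simpa using norm_integral_le_of_norm_le_const (μ := μ) (Eventually.of_forall hpt)
  have hsq := pow_le_pow_left₀ (norm_nonneg _) hG 2
  have hexp : ‖cauchyG μ z + a‖ ^ 2 = Complex.normSq (cauchyG μ z)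
      + (cauchyG μ z).im / z.im + (1 / (2 * z.im)) ^ 2 := by
    rw [← Complex.normSq_eq_norm_sq, ha]
    simp only [Complex.normSq_apply, Complex.add_re, Complex.add_im, Complex.re_ofReal_mul,
      Complex.im_ofReal_mul, Complex.I_re, Complex.I_im]
    field_simp
    ring
  rw [hexp] at hsq
  have hN : 0 < Complex.normSq (cauchyG μ z) := Complex.normSq_pos.2 (cauchyG_ne_zero μ hz)
  have h2 : Complex.normSq (cauchyG μ z) * z.im ≤ -(cauchyG μ z).im := by
    have h3 : Complex.normSq (cauchyG μ z) ≤ -(cauchyG μ z).im / z.im := by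
      rw [neg_div]; linarith
    rwa [le_div_iff₀ hz] at h3
  rw [H, Complex.sub_im, one_div, Complex.inv_im, sub_nonneg, le_div_iff₀ hN]
  linarith

theorem tendsto_mul_cauchyG (μ : Measure ℝ) [IsProbabilityMeasure μ] :
    Tendsto (fun y : ℝ => y * Complex.I * cauchyG μ (y * Complex.I)) atTop (𝓝 1) := by
  have hyim : ∀ y : ℝ, ((y : ℂ) * Complex.I).im = y := fun y => by simp
  have h := tendsto_integral_filter_of_dominated_convergence (μ := μ) (l := (atTop : Filter ℝ))
    (F := fun (y : ℝ) (t : ℝ) => (y * Complex.I) * (1 / (y * Complex.I - (t : ℂ))))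
    (f := fun _ => (1 : ℂ)) (fun _ => (1 : ℝ))
    (Eventually.of_forall fun y => Measurable.aestronglyMeasurable (by fun_prop))
    (by
      filter_upwards [eventually_gt_atTop 0] with y hy
      refine Eventually.of_forall fun t => ?_
      have h1 := im_le_norm_sub_ofReal (z := y * Complex.I) t
      rw [hyim] at h1
      rw [norm_mul, norm_mul, Complex.norm_I, mul_one, norm_div, norm_one, Complex.norm_real,
        Real.norm_of_nonneg hy.le, mul_one_div]
      exact div_le_one_of_le₀ h1 (norm_nonneg _))
    (integrable_const _)
    (Eventually.of_forall fun t => by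
      have hinv : Tendsto (fun y : ℝ => (t : ℂ) * ((y : ℂ) * Complex.I)⁻¹) atTop (𝓝 0) := by
        have h1 : Tendsto (fun y : ℝ => ‖(y : ℂ) * Complex.I‖) atTop atTop := by
          simpa using tendsto_abs_atTop_atTop
        simpa using (tendsto_inv₀_cobounded.comp
          (tendsto_norm_atTop_iff_cobounded.1 h1)).const_mul (t : ℂ)
      have h2 : Tendsto (fun y : ℝ => (1 - (t : ℂ) * ((y : ℂ) * Complex.I)⁻¹)⁻¹) atTop (𝓝 1) := by
        simpa using (hinv.const_sub 1).inv₀ (by simp)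
      refine h2.congr' ?_
      filter_upwards [eventually_gt_atTop 0] with y hy
      have hy0 : (y : ℂ) * Complex.I ≠ 0 := by simp [hy.ne']
      have hne := sub_ofReal_ne_zero (z := y * Complex.I) (by rwa [hyim]) t
      have h3 : 1 - (t : ℂ) * ((y : ℂ) * Complex.I)⁻¹
          = (y * Complex.I - t) / (y * Complex.I) := by
        rw [sub_div, div_self hy0, div_eq_mul_inv]
      rw [h3, inv_div, mul_one_div])
  simp only [integral_const_mul, integral_const, probReal_univ, one_smul] at h
  exact h

theorem tendsto_im_H_div (μ : Measure ℝ) [IsProbabilityMeasure μ] :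
    Tendsto (fun y : ℝ => (H μ (y * Complex.I)).im / y) atTop (𝓝 0) := by
  have h1 : Tendsto (fun y : ℝ => ((y * Complex.I * cauchyG μ (y * Complex.I))⁻¹ - 1).re)
      atTop (𝓝 0) := by
    have := ((tendsto_mul_cauchyG μ).inv₀ one_ne_zero).sub_const 1
    rw [inv_one, sub_self] at this
    exact (Complex.continuous_re.tendsto 0).comp this
  refine h1.congr' ?_
  filter_upwards [eventually_gt_atTop 0] with y hy
  have hyc : (y : ℂ) ≠ 0 := by exact_mod_cast hy.ne'
  have hG := cauchyG_ne_zero μ (z := y * Complex.I) (by simpa using hy)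
  have h2 : H μ (y * Complex.I)
      = y * (Complex.I * ((y * Complex.I * cauchyG μ (y * Complex.I))⁻¹ - 1)) := by
    rw [H]
    field_simp
  rw [h2, Complex.im_ofReal_mul, Complex.I_mul_im, mul_div_cancel_left₀ _ hy.ne']

/-! ### Fixed points of `g_z` and their analytic dependence on `z`. -/

section Subordination

variable (μ ν : Measure ℝ) [IsProbabilityMeasure μ] [IsProbabilityMeasure ν]

theorem im_le_im_add_H {z w : ℂ} (hw : 0 < w.im) : z.im ≤ (z + H μ w).im := by
  have := im_H_nonneg μ hw
  rw [Complex.add_im]; linarith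

theorem im_le_im_g {z w : ℂ} (hz : 0 < z.im) (hw : 0 < w.im) : z.im ≤ (g μ ν z w).im :=
  im_le_im_add_H ν (hz.trans_le (im_le_im_add_H μ hw))

theorem differentiableOn_g {z : ℂ} (hz : 0 < z.im) :
    DifferentiableOn ℂ (g μ ν z) {w | 0 < w.im} :=
  ((differentiableOn_H ν).comp ((differentiableOn_H μ).const_add z) fun _ hw =>
    hz.trans_le (im_le_im_add_H μ hw)).const_add z

theorem exists_fixed_g {z : ℂ} (hz : 0 < z.im) : ∃ p : ℂ, 0 < p.im ∧ g μ ν z p = p := by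
  refine exists_fixed_of_exists_im_lt hz (differentiableOn_g μ ν hz)
    (fun w hw => im_le_im_g μ ν hz hw) ?_
  by_contra! hcon
  obtain ⟨K, hK, hle⟩ := exists_le_im_of_comp hz ((differentiableOn_H ν).const_add z)
    ((differentiableOn_H μ).const_add z) (fun w hw => hz.trans_le (im_le_im_add_H ν hw))
    (fun w hw => im_le_im_add_H μ hw) hcon
  have hlim : Tendsto (fun y : ℝ => K * (z.im / y + (H μ (y * Complex.I)).im / y)) atTop (𝓝 0) := by
    simpa using ((tendsto_id.const_div_atTop z.im).add (tendsto_im_H_div μ)).const_mul K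
  have h1 : (1 : ℝ) ≤ 0 := by
    refine ge_of_tendsto hlim ?_
    filter_upwards [eventually_gt_atTop 0] with y hy
    have := hle (y * Complex.I) (by simpa using hy)
    rw [← add_div, ← mul_div_assoc, le_div_iff₀ hy]
    simpa using this
  linarith

/-- No continuity of `ω` is assumed: uniqueness of fixed points identifies it locally with the
implicit function of `g_x(w) - w = 0`. -/
theorem differentiableAt_fixed_g {ω : ℂ → ℂ}
    (hω : ∀ z : ℂ, 0 < z.im → 0 < (ω z).im ∧ g μ ν z (ω z) = ω z) {z : ℂ} (hz : 0 < z.im) :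
    DifferentiableAt ℂ ω z := by
  obtain ⟨hp, hfp⟩ := hω z hz
  have hopen : IsOpen {w : ℂ | 0 < w.im} := isOpen_lt continuous_const Complex.continuous_im
  have hstrict : ∀ (ρ : Measure ℝ) [IsProbabilityMeasure ρ] {w : ℂ}, 0 < w.im →
      HasStrictDerivAt (H ρ) (deriv (H ρ) w) w := fun ρ _ w hw =>
    ((differentiableOn_H ρ).analyticAt (hopen.mem_nhds hw)).hasStrictDerivAt
  set a := deriv (H μ) (ω z)
  have ha : HasStrictDerivAt (H μ) a (ω z) := hstrict μ hp
  have hu : 0 < (z + H μ (ω z)).im := hz.trans_le (im_le_im_add_H μ hp)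
  set b := deriv (H ν) (z + H μ (ω z))
  have hb : HasStrictDerivAt (H ν) b (z + H μ (ω z)) := hstrict ν hu
  have hgd : HasDerivAt (g μ ν z) (b * a) (ω z) :=
    (HasDerivAt.comp (h₂ := H ν) (h := fun w => z + H μ w) (ω z) hb.hasDerivAt
      (ha.hasDerivAt.const_add z)).const_add z
  have hne : b * a ≠ 1 := deriv_ne_one_of_fixed hz (differentiableOn_g μ ν hz)
    (fun w hw => im_le_im_g μ ν hz hw) hp hfp hgd
  have hfst : HasStrictFDerivAt (Prod.fst : ℂ × ℂ → ℂ) (.fst ℂ ℂ ℂ) (z, ω z) :=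
    hasStrictFDerivAt_fst
  have hsnd : HasStrictFDerivAt (Prod.snd : ℂ × ℂ → ℂ) (.snd ℂ ℂ ℂ) (z, ω z) :=
    hasStrictFDerivAt_snd
  have hin := hfst.add (HasStrictDerivAt.comp_hasStrictFDerivAt (z, ω z) ha hsnd)
  have hF := (hfst.add (HasStrictDerivAt.comp_hasStrictFDerivAt (z, ω z) hb hin)).sub hsnd
  set Φ : ℂ × ℂ → ℂ := fun v => g μ ν v.1 v.2 - v.2
  replace hF : HasStrictFDerivAt Φ _ (z, ω z) := hF
  -- The partial derivative in `w` is multiplication by `b * a - 1`.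
  have hinv : ((ContinuousLinearMap.fst ℂ ℂ ℂ + b • (ContinuousLinearMap.fst ℂ ℂ ℂ +
      a • ContinuousLinearMap.snd ℂ ℂ ℂ) - ContinuousLinearMap.snd ℂ ℂ ℂ) ∘L
      .inr ℂ ℂ ℂ).IsInvertible := by
    have hu0 : b * a - 1 ≠ 0 := sub_ne_zero.2 hne
    refine ⟨ContinuousLinearEquiv.unitsEquivAut ℂ (Units.mk0 _ hu0), ?_⟩
    ext
    simp
  set ψ := hF.implicitFunctionOfProdDomain hinv
  have hψd : DifferentiableAt ℂ ψ z :=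
    (hF.hasStrictFDerivAt_implicitFunctionOfProdDomain hinv).differentiableAt
  have hψt : Tendsto ψ (𝓝 z) (𝓝 (ω z)) := hF.tendsto_implicitFunctionOfProdDomain hinv
  have hψe : ∀ᶠ x in 𝓝 z, Φ (x, ψ x) = Φ (z, ω z) :=
    hF.eventually_apply_implicitFunctionOfProdDomain hinv
  refine hψd.congr_of_eventuallyEq ?_
  filter_upwards [hψe, hψt.eventually (hopen.mem_nhds hp), hopen.mem_nhds hz] with x h1 h2 h3
  have h4 : g μ ν x (ψ x) = ψ x := by
    have h5 : g μ ν x (ψ x) - ψ x = g μ ν z (ω z) - ω z := h1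
    rw [hfp, sub_self] at h5
    exact sub_eq_zero.1 h5
  exact fixed_unique h3 (differentiableOn_g μ ν h3) (fun w hw => im_le_im_g μ ν h3 hw)
    h2 h4 (hω x h3).1 (hω x h3).2

end Subordination

end FreeSubordination

theorem mainTheorem7 (μ ν : MeasureTheory.Measure ℝ)
    [MeasureTheory.IsProbabilityMeasure μ] [MeasureTheory.IsProbabilityMeasure ν] :
    -- each `g_z` is a well-defined self-map of the upper half-plane
    (∀ z ∈ UpperHalfPlane.upperHalfPlaneSet, ∀ w ∈ UpperHalfPlane.upperHalfPlaneSet,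
      z + FreeSubordination.H μ w ∈ UpperHalfPlane.upperHalfPlaneSet ∧
      FreeSubordination.g μ ν z w ∈ UpperHalfPlane.upperHalfPlaneSet) ∧
    ∃ ω : ℂ → ℂ,
      (∀ z ∈ UpperHalfPlane.upperHalfPlaneSet,
        -- `ω z` is a fixed point of `g_z` in the upper half-plane, and the only one
        ω z ∈ UpperHalfPlane.upperHalfPlaneSet ∧
        FreeSubordination.g μ ν z (ω z) = ω z ∧
        (∀ w ∈ UpperHalfPlane.upperHalfPlaneSet, FreeSubordination.g μ ν z w = w → w = ω z) ∧
        -- the iterates of `g_z` converge to it from every starting point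
        ∀ z₀ ∈ UpperHalfPlane.upperHalfPlaneSet,
          Filter.Tendsto (fun n : ℕ => (FreeSubordination.g μ ν z)^[n] z₀)
            Filter.atTop (nhds (ω z))) ∧
      AnalyticOnNhd ℂ ω UpperHalfPlane.upperHalfPlaneSet := by
  refine ⟨fun z hz w hw => ⟨lt_of_lt_of_le hz (FreeSubordination.im_le_im_add_H μ hw),
    lt_of_lt_of_le hz (FreeSubordination.im_le_im_g μ ν hz hw)⟩, ?_⟩
  have hex : ∀ z : ℂ, ∃ p : ℂ, 0 < z.im → 0 < p.im ∧ FreeSubordination.g μ ν z p = p := by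
    intro z
    by_cases hz : 0 < z.im
    · obtain ⟨p, hp⟩ := FreeSubordination.exists_fixed_g μ ν hz
      exact ⟨p, fun _ => hp⟩
    · exact ⟨0, fun h => absurd h hz⟩
  choose ω hω using hex
  refine ⟨ω, fun z hz => ?_, ?_⟩
  · have hd := FreeSubordination.differentiableOn_g μ ν hz
    have him := fun w hw => FreeSubordination.im_le_im_g μ ν (z := z) (w := w) hz hw
    obtain ⟨hp, hfp⟩ := hω z hz
    exact ⟨hp, hfp, fun w hw hfw => FreeSubordination.fixed_unique hz hd him hp hfp hw hfw,
      fun z₀ hz₀ => FreeSubordination.tendsto_iterate_of_fixed hz hd him hp hfp hz₀⟩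
  · exact DifferentiableOn.analyticOnNhd
      (fun z hz => (FreeSubordination.differentiableAt_fixed_g μ ν hω hz).differentiableWithinAt)
      UpperHalfPlane.isOpen_upperHalfPlaneSet
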